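/- Let $(X,\rho)$ be a metric space (not assumed separable). Let $\mathcal P(X)$ be the set of Radon probability measures on $X$, i.e. probability measures $\mu$ on the Borel $\sigma$-algebra $\mathcal B(X)$ with $\mu(A)=\sup\{\mu(K): K\subset A \text{ compact}\}$ for all $A\in\mathcal B(X)$, and define $\mathcal P(X\times X)$ likewise, with the Borel $\sigma$-algebra of the product topology. For $\mu,\nu\in\mathcal P(X)$ let $\Xi_X(\mu,\nu)$ be the set of all $\sigma\in\mathcal P(X\times X)$ such that $\sigma(A\times X)=\mu(A)$ and $\sigma(X\times A)=\nu(A)$ for all $A\in\mathcal B(X)$, and let $$\rho_W(\mu,\nu):=\inf_{\sigma\in\Xi_X(\mu,\nu)}\int_{X\times X}\rho(x,y)\,\sigma(dx,dy)\in[0,\infty].$$ Let $\mathcal P_1(X)$ be the set of all $\mu\in\mathcal P(X)$ such that $\int_X\rho(x,x_0)\,\mu(dx)<\infty$ for some (and hence all) $x_0\in X$. Then: (i) $\rho_W$ is a (finite) metric on $\mathcal P_1(X)$. (ii) If $(X,\rho)$ is a complete metric space, then so is $(\mathcal P_1(X),\rho_W)$. -/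

import Mathlib

open MeasureTheory

open scoped ENNReal

/-- `RadonProb X` is the set of Radon probability measures on the topological space `X`: the
probability measures on the Borel σ-algebra of `X` which are inner regular with respect to compact
sets on all Borel sets. The σ-algebra is always `borel X`; in particular
`RadonProb (X × X)` consists of measures on the Borel σ-algebra of the product topology, which for
non-separable `X` may be larger than the product of the Borel σ-algebras. -/
structure RadonProb (X : Type*) [TopologicalSpace X] where
  /-- the underlying Borel measure -/
  toMeasure : @Measure X (borel X)
  isProbabilityMeasure : @IsProbabilityMeasure X (borel X) toMeasure
  innerRegular : @Measure.InnerRegular X (borel X) _ toMeasure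

namespace RadonProb

/-- The integral over `X` of a `[0, ∞]`-valued function against a Radon probability measure. -/
noncomputable def lint {X : Type*} [TopologicalSpace X] (μ : RadonProb X) (f : X → ℝ≥0∞) : ℝ≥0∞ :=
  @lintegral X (borel X) μ.toMeasure f

/-- The set of Radon couplings of `μ` and `ν`: the Radon probability measures `σ` on `X × X` with
`σ (A × X) = μ A` and `σ (X × A) = ν A` for every Borel set `A`. -/
def couplings {X : Type*} [TopologicalSpace X] (μ ν : RadonProb X) : Set (RadonProb (X × X)) :=
  {σ | ∀ A : Set X, MeasurableSet[borel X] A →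
    σ.toMeasure (A ×ˢ Set.univ) = μ.toMeasure A ∧ σ.toMeasure (Set.univ ×ˢ A) = ν.toMeasure A}

/-- The Wasserstein distance, with values in `[0, ∞]`: the infimum over the Radon couplings `σ` of
`μ` and `ν` of the integral of the distance against `σ`. -/
noncomputable def wasserstein {X : Type*} [MetricSpace X] (μ ν : RadonProb X) : ℝ≥0∞ :=
  ⨅ σ ∈ couplings μ ν, σ.lint fun p => ENNReal.ofReal (dist p.1 p.2)

end RadonProb

/-- The Radon probability measures with finite first moment. -/
def RadonProbOne (X : Type*) [MetricSpace X] : Set (RadonProb X) :=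
  {μ | ∃ x₀ : X, μ.lint (fun x => ENNReal.ofReal (dist x x₀)) < ∞}

open Filter Topology ProbabilityTheory

/-!
# The Wasserstein metric on Radon probability measures

All axioms except the triangle inequality are direct. A coupling can be swapped, the diagonal
couples `μ` with itself, and coupling with a Dirac measure bounds the distance to it by a first
moment. If the distance is `0`, Markov's inequality for nearly optimal couplings gives
`ν F ≤ μ (thickening δ F)` for every closed `F` and every `δ > 0`
(`RadonProb.measure_le_measure_thickening_add`), hence `ν F ≤ μ F`, and by symmetry `μ = ν`.

The triangle inequality and completeness both come from gluing: given couplings `σ n` of `μ n`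
and `μ (n + 1)`, there is one probability measure on sequences `ω` under which
`(ω n, ω (n + 1))` has law `σ n` for every `n`. On a standard Borel space the `σ n` disintegrate,
and the Ionescu-Tulcea theorem applied to the conditional kernels produces this measure
(`MeasureTheory.Measure.exists_map_eval_succ_eq`). The space `X` itself need not be separable, so
the gluing takes place on a subspace `Y` carrying all the measures. A Radon probability measure is
carried by a σ-compact set, so countably many of them are carried by a common σ-compact set.

* For the triangle inequality, `Y` is this σ-compact set. It is a Borel subset of its (Polish)
  completion, hence standard Borel, and every finite Borel measure on it or its square is Radon.
  The inequality is then `edist (ω 0) (ω 2) ≤ edist (ω 0) (ω 1) + edist (ω 1) (ω 2)`, integrated.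
* For completeness, `Y` is the closure of this σ-compact set, which is Polish when `X` is complete.
  If consecutive distances are summable, then so is the expectation of
  `∑ edist (ω n) (ω (n + 1))`; so `ω` converges almost surely, and the law of its limit is the limit
  of the `μ n` (`RadonProb.exists_wasserstein_le_tsum`).

Any sequence satisfying a geometric Cauchy bound therefore converges, which suffices for
completeness.
-/

/-! ### Gluing a chain of couplings -/

namespace MeasureTheory.Measure

theorem map_prodMap_compProd_comap {A B C : Type*} [MeasurableSpace A] [MeasurableSpace B]
    [MeasurableSpace C] (ρ : Measure A) [SFinite ρ] (κ : Kernel B C) [IsSFiniteKernel κ]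
    {g : A → B} (hg : Measurable g) :
    (ρ ⊗ₘ κ.comap g hg).map (Prod.map g id) = ρ.map g ⊗ₘ κ := by
  ext s hs
  rw [map_apply (by fun_prop) hs, compProd_apply (by measurability), compProd_apply hs,
    lintegral_map (Kernel.measurable_kernel_prodMk_left hs) hg]
  rfl

/-- A chain of couplings in which neighbours share a marginal is realized by a single random
sequence: the conditional kernels of the couplings are the transition kernels of a Markov chain. -/
theorem exists_map_eval_succ_eq {Y : Type*} [MeasurableSpace Y] [StandardBorelSpace Y]
    [Nonempty Y] (σ : ℕ → Measure (Y × Y)) [∀ n, IsProbabilityMeasure (σ n)]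
    (h : ∀ n, (σ n).snd = (σ (n + 1)).fst) :
    ∃ P : Measure (ℕ → Y), IsProbabilityMeasure P ∧
      ∀ n, P.map (fun ω => (ω n, ω (n + 1))) = σ n := by
  let g : (n : ℕ) → ((i : Finset.Iic n) → Y) → Y := fun n x => x ⟨n, by simp⟩
  have hg : ∀ n, Measurable (g n) := fun n => measurable_pi_apply _
  let κ : (n : ℕ) → Kernel ((i : Finset.Iic n) → Y) Y := fun n =>
    (σ n).condKernel.comap (g n) (hg n)
  let P : Measure (ℕ → Y) := Kernel.trajMeasure (X := fun _ => Y) (σ 0).fst κ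
  have hP : IsProbabilityMeasure P := by
    unfold P; infer_instance
  have hstep : ∀ n, P.map (fun ω => ω n) = (σ n).fst →
      P.map (fun ω => (ω n, ω (n + 1))) = σ n := by
    intro n hn
    -- Forget all of the past except its last point, on which alone the transition kernel depends.
    have key := Kernel.map_frestrictLe_trajMeasure_compProd_eq_map_trajMeasure
      (X := fun _ => Y) (μ₀ := (σ 0).fst) (κ := κ) (a := n)
    have key' := congrArg (fun m => Measure.map (Prod.map (g n) id) m) key
    have hm : Measurable (Preorder.frestrictLe (π := fun _ : ℕ => Y) n) := by fun_prop
    simp only [κ] at key'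
    rw [map_prodMap_compProd_comap _ _ (hg n), map_map (hg n) hm,
      map_map ((hg n).prodMap measurable_id) (by fun_prop)] at key'
    change P.map (fun ω => ω n) ⊗ₘ _ = P.map (fun ω => (ω n, ω (n + 1))) at key'
    rw [← key', hn, (σ n).disintegrate]
  -- The second marginal of `σ n` is the first marginal of `σ (n + 1)`, so the laws propagate.
  have hmarg : ∀ n, P.map (fun ω => ω n) = (σ n).fst := by
    intro n
    induction n with
    | zero =>
      have h0 : P.map (Preorder.frestrictLe (π := fun _ : ℕ => Y) 0) =
          (σ 0).fst.map (MeasurableEquiv.piUnique (fun i : Finset.Iic 0 => Y)).symm := by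
        simp only [P, Kernel.trajMeasure]
        rw [Measure.map_comp _ _ (by fun_prop), Kernel.traj_map_frestrictLe,
          Kernel.partialTraj_self, Measure.id_comp]
      have h1 := congrArg (fun m => Measure.map (g 0) m) h0
      change Measure.map (g 0) _ = Measure.map (g 0) _ at h1
      rw [map_map (hg 0) (by fun_prop), map_map (hg 0) (by fun_prop)] at h1
      refine h1.trans ?_
      convert Measure.map_id
      ext y
      rfl
    | succ n ih =>
      rw [← h n, ← hstep n ih, snd, map_map measurable_snd (by fun_prop)]
      rfl
  exact ⟨P, hP, fun n => hstep n (hmarg n)⟩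

end MeasureTheory.Measure

/-! ### Radon probability measures: images, restrictions, supports -/

namespace RadonProb

variable {X Z Z' : Type*}

/-- The image under a continuous map `g` of an inner regular probability measure `ρ`, as a Radon
probability measure. The source carries its own Borel σ-algebra, which may be a product one,
whereas the target always gets `borel Z'`. -/
noncomputable def ofMap [TopologicalSpace Z] [MeasurableSpace Z] [BorelSpace Z]
    [TopologicalSpace Z'] (ρ : Measure Z) [IsProbabilityMeasure ρ] [ρ.InnerRegular]
    (g : Z → Z') (hg : Continuous g) : RadonProb Z' :=
  letI : MeasurableSpace Z' := borel Z'
  haveI : BorelSpace Z' := ⟨rfl⟩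
  { toMeasure := ρ.map g
    isProbabilityMeasure := Measure.isProbabilityMeasure_map hg.measurable.aemeasurable
    innerRegular := Measure.InnerRegular.map_of_continuous hg }

theorem ofMap_apply [TopologicalSpace Z] [MeasurableSpace Z] [BorelSpace Z]
    [TopologicalSpace Z'] (ρ : Measure Z) [IsProbabilityMeasure ρ] [ρ.InnerRegular]
    {g : Z → Z'} (hg : Continuous g) {A : Set Z'} (hA : MeasurableSet[borel Z'] A) :
    (ofMap ρ g hg).toMeasure A = ρ (g ⁻¹' A) := by
  let _ : MeasurableSpace Z' := borel Z'
  have _ : BorelSpace Z' := ⟨rfl⟩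
  exact Measure.map_apply hg.measurable hA

theorem lint_ofMap [TopologicalSpace Z] [MeasurableSpace Z] [BorelSpace Z]
    [TopologicalSpace Z'] (ρ : Measure Z) [IsProbabilityMeasure ρ] [ρ.InnerRegular]
    {g : Z → Z'} (hg : Continuous g) {f : Z' → ℝ≥0∞} (hf : Continuous f) :
    (ofMap ρ g hg).lint f = ∫⁻ z, f (g z) ∂ρ := by
  let _ : MeasurableSpace Z' := borel Z'
  have _ : BorelSpace Z' := ⟨rfl⟩
  exact lintegral_map hf.measurable hg.measurable

/-- The image of a Radon probability measure under a continuous map. -/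
noncomputable def map [TopologicalSpace Z] [TopologicalSpace Z'] (μ : RadonProb Z)
    (g : Z → Z') (hg : Continuous g) : RadonProb Z' :=
  letI : MeasurableSpace Z := borel Z
  haveI : BorelSpace Z := ⟨rfl⟩
  haveI := μ.isProbabilityMeasure
  haveI := μ.innerRegular
  ofMap μ.toMeasure g hg

theorem map_apply [TopologicalSpace Z] [TopologicalSpace Z'] (μ : RadonProb Z)
    {g : Z → Z'} (hg : Continuous g) {A : Set Z'} (hA : MeasurableSet[borel Z'] A) :
    (μ.map g hg).toMeasure A = μ.toMeasure (g ⁻¹' A) := by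
  let _ : MeasurableSpace Z := borel Z
  have _ : BorelSpace Z := ⟨rfl⟩
  have := μ.isProbabilityMeasure
  have := μ.innerRegular
  exact ofMap_apply μ.toMeasure hg hA

theorem lint_map [TopologicalSpace Z] [TopologicalSpace Z'] (μ : RadonProb Z)
    {g : Z → Z'} (hg : Continuous g) {f : Z' → ℝ≥0∞} (hf : Continuous f) :
    (μ.map g hg).lint f = μ.lint fun z => f (g z) := by
  let _ : MeasurableSpace Z := borel Z
  have _ : BorelSpace Z := ⟨rfl⟩
  have := μ.isProbabilityMeasure
  have := μ.innerRegular
  exact lint_ofMap μ.toMeasure hg hf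

theorem ext_of_isClosed [TopologicalSpace X] {μ ν : RadonProb X}
    (h : ∀ F : Set X, IsClosed F → μ.toMeasure F = ν.toMeasure F) : μ = ν := by
  let _ : MeasurableSpace X := borel X
  have _ : BorelSpace X := ⟨rfl⟩
  obtain ⟨m, hm, hm'⟩ := μ
  obtain ⟨n, hn, hn'⟩ := ν
  have : m = n := by
    refine ext_of_generate_finite {s | IsClosed s} borel_eq_generateFrom_isClosed
      isPiSystem_isClosed (fun F hF => h F hF) (by simp)
  subst this
  rfl

theorem ext_of_borel [TopologicalSpace X] {μ ν : RadonProb X}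
    (h : ∀ A : Set X, MeasurableSet[borel X] A → μ.toMeasure A = ν.toMeasure A) : μ = ν := by
  let _ : MeasurableSpace X := borel X
  have _ : BorelSpace X := ⟨rfl⟩
  exact ext_of_isClosed fun F hF => h F hF.measurableSet

/-- A Radon probability measure carried by the Borel range of an embedding is the image of a
probability measure on the embedded space. -/
theorem exists_measure_of_isEmbedding [TopologicalSpace Z] [MeasurableSpace Z] [BorelSpace Z]
    [TopologicalSpace Z'] (μ : RadonProb Z') {e : Z → Z'} (he : IsEmbedding e)
    (hr : MeasurableSet[borel Z'] (Set.range e)) (hμ : μ.toMeasure (Set.range e)ᶜ = 0) :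
    ∃ ρ : Measure Z, IsProbabilityMeasure ρ ∧
      (∀ A, MeasurableSet[borel Z'] A → ρ (e ⁻¹' A) = μ.toMeasure A) ∧
      ∀ f : Z' → ℝ≥0∞, Continuous f → ∫⁻ z, f (e z) ∂ρ = μ.lint f := by
  let _ : MeasurableSpace Z' := borel Z'
  have _ : BorelSpace Z' := ⟨rfl⟩
  have := μ.isProbabilityMeasure
  have hm : MeasurableEmbedding e := he.measurableEmbedding hr
  have hmap : (μ.toMeasure.comap e).map e = μ.toMeasure := by
    rw [hm.map_comap, Measure.restrict_eq_self_of_ae_mem]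
    exact hμ
  have hA : ∀ A, MeasurableSet A → μ.toMeasure.comap e (e ⁻¹' A) = μ.toMeasure A := by
    intro A hA
    rw [← Measure.map_apply hm.measurable hA, hmap]
  refine ⟨μ.toMeasure.comap e, ⟨?_⟩, hA, fun f hf => ?_⟩
  · simpa using hA Set.univ MeasurableSet.univ
  · rw [← lintegral_map hf.measurable hm.measurable, hmap]
    rfl

/-- Every Radon probability measure is carried by a σ-compact set; in a metric space, this is
what reduces arguments to separable subspaces. -/
theorem exists_isSigmaCompact [TopologicalSpace X] [T2Space X] (μ : RadonProb X) :
    ∃ S : Set X, IsSigmaCompact S ∧ μ.toMeasure Sᶜ = 0 := by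
  let _ : MeasurableSpace X := borel X
  have _ : BorelSpace X := ⟨rfl⟩
  have := μ.isProbabilityMeasure
  have := μ.innerRegular
  have h : ∀ n : ℕ, ∃ K, IsCompact K ∧ μ.toMeasure Kᶜ < (n : ℝ≥0∞)⁻¹ := by
    intro n
    obtain ⟨K, -, hK, hlt⟩ := MeasurableSet.univ.exists_isCompact_sdiff_lt
      (measure_ne_top μ.toMeasure _) (ENNReal.inv_ne_zero.2 (ENNReal.natCast_ne_top n))
    exact ⟨K, hK, by rwa [Set.compl_eq_univ_sdiff]⟩
  choose K hK hlt using h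
  refine ⟨⋃ n, K n, isSigmaCompact_iUnion_of_isCompact K hK, ?_⟩
  refine le_antisymm (ge_of_tendsto' ENNReal.tendsto_inv_nat_nhds_zero fun n => ?_) zero_le
  exact (measure_mono (Set.compl_subset_compl.2 (Set.subset_iUnion K n))).trans (hlt n).le

end RadonProb

/-! ### σ-compact metric spaces -/

theorem IsSigmaCompact.measurableSet {X : Type*} [TopologicalSpace X] [T2Space X]
    [MeasurableSpace X] [BorelSpace X] {S : Set X} (hS : IsSigmaCompact S) : MeasurableSet S := by
  obtain ⟨K, hK, rfl⟩ := hS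
  exact MeasurableSet.iUnion fun n => (hK n).measurableSet

theorem IsSigmaCompact.isSeparable {X : Type*} [PseudoMetricSpace X] {S : Set X}
    (hS : IsSigmaCompact S) : TopologicalSpace.IsSeparable S := by
  obtain ⟨K, hK, rfl⟩ := hS
  exact TopologicalSpace.IsSeparable.iUnion fun n => (hK n).isSeparable

theorem MeasurableEquiv.standardBorelSpace {A B : Type*} [MeasurableSpace A] [MeasurableSpace B]
    [StandardBorelSpace B] (e : A ≃ᵐ B) : StandardBorelSpace A := by
  obtain ⟨t, hb, hp⟩ := StandardBorelSpace.polish (α := B)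
  let _ : TopologicalSpace A := TopologicalSpace.induced e t
  refine ⟨inferInstance, ⟨?_⟩, e.toEquiv.polishSpace_induced⟩
  have h := e.measurableEmbedding.comap_eq
  obtain rfl := hb.measurable_eq
  exact h.symm.trans borel_comap.symm

/-- A σ-compact metric space need not be Polish, but it is a countable union of compact, hence
Borel, subsets of its Polish completion. -/
theorem StandardBorelSpace.of_sigmaCompactSpace {S : Type*} [MetricSpace S] [SigmaCompactSpace S]
    [MeasurableSpace S] [BorelSpace S] : StandardBorelSpace S := by
  let _ : MeasurableSpace (UniformSpace.Completion S) := borel _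
  have _ : BorelSpace (UniformSpace.Completion S) := ⟨rfl⟩
  have _ : SecondCountableTopology (UniformSpace.Completion S) :=
    UniformSpace.secondCountable_of_separable _
  have he : IsEmbedding ((↑) : S → UniformSpace.Completion S) :=
    UniformSpace.Completion.coe_isometry.isEmbedding
  have hr : MeasurableSet (Set.range ((↑) : S → UniformSpace.Completion S)) :=
    (isSigmaCompact_range he.continuous).measurableSet
  have := hr.standardBorel
  exact (he.measurableEmbedding hr).equivRange.standardBorelSpace

namespace RadonProb

variable {X : Type*} [MetricSpace X]

/-! ### First properties of the Wasserstein distance -/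

theorem continuous_ofReal_dist :
    Continuous fun p : X × X => ENNReal.ofReal (dist p.1 p.2) :=
  ENNReal.continuous_ofReal.comp continuous_dist

theorem borel_preimage {A B : Type*} [TopologicalSpace A] [TopologicalSpace B] {f : A → B}
    (hf : Continuous f) {s : Set B} (hs : MeasurableSet[borel B] s) :
    MeasurableSet[borel A] (f ⁻¹' s) :=
  hf.borel_measurable hs

theorem measurableSet_preimage {A B : Type*} [TopologicalSpace A] [MeasurableSpace A]
    [BorelSpace A] [TopologicalSpace B] {f : A → B} (hf : Continuous f) {s : Set B}
    (hs : MeasurableSet[borel B] s) : MeasurableSet (f ⁻¹' s) := by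
  rw [BorelSpace.measurable_eq (α := A)]
  exact borel_preimage hf hs

theorem lint_mono {Z : Type*} [TopologicalSpace Z] (μ : RadonProb Z) {f g : Z → ℝ≥0∞}
    (h : ∀ z, f z ≤ g z) : μ.lint f ≤ μ.lint g := by
  let _ : MeasurableSpace Z := borel Z
  exact lintegral_mono h

theorem lint_add {Z : Type*} [TopologicalSpace Z] (μ : RadonProb Z) {f : Z → ℝ≥0∞}
    (hf : Continuous f) (g : Z → ℝ≥0∞) :
    μ.lint (fun z => f z + g z) = μ.lint f + μ.lint g := by
  let _ : MeasurableSpace Z := borel Z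
  have _ : BorelSpace Z := ⟨rfl⟩
  exact lintegral_add_left hf.measurable g

theorem lint_const {Z : Type*} [TopologicalSpace Z] (μ : RadonProb Z) (c : ℝ≥0∞) :
    μ.lint (fun _ => c) = c := by
  let _ : MeasurableSpace Z := borel Z
  have := μ.isProbabilityMeasure
  exact (lintegral_const c).trans (by simp)

theorem wasserstein_le_lint {μ ν : RadonProb X} {σ : RadonProb (X × X)} (h : σ ∈ couplings μ ν) :
    wasserstein μ ν ≤ σ.lint fun p => ENNReal.ofReal (dist p.1 p.2) :=
  iInf₂_le σ h

theorem map_fst_eq {μ ν : RadonProb X} {σ : RadonProb (X × X)} (h : σ ∈ couplings μ ν) :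
    σ.map Prod.fst continuous_fst = μ :=
  ext_of_borel fun A hA => by
    rw [map_apply _ _ hA, ← (h A hA).1, Set.prod_univ]

theorem map_snd_eq {μ ν : RadonProb X} {σ : RadonProb (X × X)} (h : σ ∈ couplings μ ν) :
    σ.map Prod.snd continuous_snd = ν :=
  ext_of_borel fun A hA => by
    rw [map_apply _ _ hA, ← (h A hA).2, Set.univ_prod]

theorem map_prodMk_mem_couplings {Z : Type*} [TopologicalSpace Z] (μ : RadonProb Z)
    {f g : Z → X} (hf : Continuous f) (hg : Continuous g) :
    μ.map (fun z => (f z, g z)) (hf.prodMk hg) ∈ couplings (μ.map f hf) (μ.map g hg) := by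
  intro A hA
  rw [map_apply _ _ hA, map_apply _ _ hA, Set.prod_univ, Set.univ_prod,
    map_apply _ _ (borel_preimage continuous_fst hA),
    map_apply _ _ (borel_preimage continuous_snd hA)]
  exact ⟨rfl, rfl⟩

theorem wasserstein_map_le {Z : Type*} [TopologicalSpace Z] (μ : RadonProb Z)
    {f g : Z → X} (hf : Continuous f) (hg : Continuous g) :
    wasserstein (μ.map f hf) (μ.map g hg) ≤ μ.lint fun z => ENNReal.ofReal (dist (f z) (g z)) :=
  (wasserstein_le_lint (map_prodMk_mem_couplings μ hf hg)).trans_eq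
    (lint_map _ _ continuous_ofReal_dist)

theorem map_id (μ : RadonProb X) : μ.map id continuous_id = μ :=
  ext_of_borel fun A hA => by rw [map_apply _ _ hA, Set.preimage_id]

/-- The image under a constant map is the Dirac measure, whatever the original measure. -/
theorem map_const (μ ν : RadonProb X) (x : X) :
    μ.map (fun _ => x) continuous_const = ν.map (fun _ => x) continuous_const :=
  ext_of_borel fun A hA => by
    let _ : MeasurableSpace X := borel X
    have := μ.isProbabilityMeasure
    have := ν.isProbabilityMeasure
    rw [map_apply _ _ hA, map_apply _ _ hA]
    by_cases hx : x ∈ A <;> simp [hx]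

theorem wasserstein_self (μ : RadonProb X) : wasserstein μ μ = 0 := by
  have h := wasserstein_map_le μ (continuous_id (X := X)) continuous_id
  rw [map_id] at h
  simpa [lint_const] using h

theorem wasserstein_comm_le (μ ν : RadonProb X) : wasserstein μ ν ≤ wasserstein ν μ := by
  refine le_iInf₂ fun σ hσ => ?_
  have h := wasserstein_map_le σ continuous_snd continuous_fst
  rw [map_fst_eq hσ, map_snd_eq hσ] at h
  simpa only [dist_comm] using h

theorem wasserstein_comm (μ ν : RadonProb X) : wasserstein μ ν = wasserstein ν μ :=
  (wasserstein_comm_le μ ν).antisymm (wasserstein_comm_le ν μ)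

theorem lint_dist_le_add_wasserstein (μ ν : RadonProb X) (x : X) :
    ν.lint (fun y => ENNReal.ofReal (dist y x)) ≤
      μ.lint (fun y => ENNReal.ofReal (dist y x)) + wasserstein μ ν := by
  simp_rw [wasserstein, ENNReal.add_iInf]
  refine le_iInf₂ fun σ hσ => ?_
  have hc : Continuous fun y : X => ENNReal.ofReal (dist y x) :=
    ENNReal.continuous_ofReal.comp (by fun_prop)
  have hc' : Continuous fun p : X × X => ENNReal.ofReal (dist p.1 x) := hc.comp continuous_fst
  rw [← map_snd_eq hσ, ← map_fst_eq hσ, lint_map _ _ hc, lint_map _ _ hc,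
    ← lint_add _ hc']
  refine lint_mono _ fun p => ?_
  rw [← ENNReal.ofReal_add dist_nonneg dist_nonneg]
  refine ENNReal.ofReal_le_ofReal ?_
  rw [add_comm, dist_comm p.1 p.2]
  exact dist_triangle _ _ _

/-- Under a coupling of `μ` and `ν`, a pair whose second point lies in `F` has its first point
within `δ` of `F`, unless its two points are at distance at least `δ`; Markov's inequality bounds
the probability of the latter. -/
theorem measure_le_measure_thickening_add (μ ν : RadonProb X) {F : Set X} (hF : IsClosed F)
    {δ : ℝ} (hδ : 0 < δ) :
    ν.toMeasure F ≤ μ.toMeasure (Metric.thickening δ F) +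
      wasserstein μ ν / ENNReal.ofReal δ := by
  -- It suffices to compare with a single coupling, so the infimum is pulled out of the bound.
  simp_rw [wasserstein, ENNReal.div_eq_inv_mul]
  rw [ENNReal.mul_iInf_of_ne (by simp) (by simpa using hδ)]
  simp_rw [ENNReal.mul_iInf_of_ne (a := (ENNReal.ofReal δ)⁻¹) (by simp) (by simpa using hδ),
    ENNReal.add_iInf]
  refine le_iInf₂ fun σ hσ => ?_
  let _ : MeasurableSpace X := borel X
  have _ : BorelSpace X := ⟨rfl⟩
  have hT : MeasurableSet (Metric.thickening δ F) := Metric.isOpen_thickening.measurableSet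
  rw [← (hσ F hF.measurableSet).2, ← (hσ _ hT).1, ← ENNReal.div_eq_inv_mul]
  have hmarkov := @mul_meas_ge_le_lintegral _ (borel (X × X)) σ.toMeasure _
    continuous_ofReal_dist.borel_measurable (ENNReal.ofReal δ)
  have hsub : (Set.univ : Set X) ×ˢ F ⊆ Metric.thickening δ F ×ˢ (Set.univ : Set X) ∪
      {p | ENNReal.ofReal δ ≤ ENNReal.ofReal (dist p.1 p.2)} := by
    rintro ⟨x, y⟩ ⟨-, hy⟩
    by_cases h : dist x y < δ
    · exact Or.inl ⟨Metric.mem_thickening_iff.2 ⟨y, hy, h⟩, trivial⟩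
    · exact Or.inr (ENNReal.ofReal_le_ofReal (not_lt.1 h))
  refine (measure_mono hsub).trans ((measure_union_le _ _).trans (add_le_add le_rfl ?_))
  rw [ENNReal.le_div_iff_mul_le (by simp [hδ]) (by simp), mul_comm]
  exact hmarkov

theorem measure_le_of_wasserstein_eq_zero {μ ν : RadonProb X} (h : wasserstein μ ν = 0)
    {F : Set X} (hF : IsClosed F) : ν.toMeasure F ≤ μ.toMeasure F := by
  let _ : MeasurableSpace X := borel X
  have _ : BorelSpace X := ⟨rfl⟩
  have := μ.isProbabilityMeasure
  refine ge_of_tendsto (tendsto_measure_thickening_of_isClosed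
    ⟨1, one_pos, measure_ne_top μ.toMeasure _⟩ hF) ?_
  filter_upwards [self_mem_nhdsWithin] with δ hδ
  simpa [h] using measure_le_measure_thickening_add μ ν hF hδ

theorem eq_of_wasserstein_eq_zero {μ ν : RadonProb X} (h : wasserstein μ ν = 0) : μ = ν :=
  ext_of_isClosed fun _ hF =>
    (measure_le_of_wasserstein_eq_zero (wasserstein_comm μ ν ▸ h) hF).antisymm
      (measure_le_of_wasserstein_eq_zero h hF)

end RadonProb

namespace RadonProb

variable {X : Type*} [MetricSpace X]

/-! ### Realizing couplings by random points of a separable subspace -/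

/-- Random points `f` and `g` of `Y` whose images in `X` have laws `μ` and `ν` bound the distance
of `μ` and `ν`. Because `Y` is second countable, `(f, g)` is measurable for the Borel σ-algebra of
`Y × Y`, and therefore its image in `X × X` is Borel even if `X` is not separable. -/
theorem wasserstein_le_lintegral_edist {Ω Y : Type*} [MeasurableSpace Ω] (P : Measure Ω)
    [IsProbabilityMeasure P] [MetricSpace Y] [SecondCountableTopology Y] [MeasurableSpace Y]
    [BorelSpace Y] (hreg : ∀ ρ : Measure (Y × Y), IsFiniteMeasure ρ → ρ.InnerRegular)
    {e : Y → X} (he : Isometry e) {f g : Ω → Y} (hf : Measurable f) (hg : Measurable g)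
    {μ ν : RadonProb X}
    (hμ : ∀ A, MeasurableSet[borel X] A → P {ω | e (f ω) ∈ A} = μ.toMeasure A)
    (hν : ∀ A, MeasurableSet[borel X] A → P {ω | e (g ω) ∈ A} = ν.toMeasure A) :
    wasserstein μ ν ≤ ∫⁻ ω, edist (f ω) (g ω) ∂P := by
  have hfg : Measurable fun ω => (f ω, g ω) := hf.prodMk hg
  have : IsProbabilityMeasure (P.map fun ω => (f ω, g ω)) :=
    Measure.isProbabilityMeasure_map hfg.aemeasurable
  have := hreg (P.map fun ω => (f ω, g ω)) inferInstance
  have hee : Continuous (Prod.map e e) := he.continuous.prodMap he.continuous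
  have hmem : ofMap (P.map fun ω => (f ω, g ω)) (Prod.map e e) hee ∈ couplings μ ν := by
    intro A hA
    have hpre : MeasurableSet (e ⁻¹' A) := measurableSet_preimage he.continuous hA
    rw [Set.prod_univ, Set.univ_prod, ofMap_apply _ _ (borel_preimage continuous_fst hA),
      ofMap_apply _ _ (borel_preimage continuous_snd hA)]
    constructor
    · rw [← hμ A hA]
      exact Measure.map_apply hfg (measurable_fst hpre)
    · rw [← hν A hA]
      exact Measure.map_apply hfg (measurable_snd hpre)
  refine (wasserstein_le_lint hmem).trans_eq ?_
  rw [lint_ofMap _ _ continuous_ofReal_dist]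
  simp only [Prod.map_fst, Prod.map_snd, ← edist_dist, he.edist_eq]
  exact lintegral_map (by fun_prop) hfg

/-- Gluing of couplings of Radon probability measures carried by an isometric copy in `X` of a
separable standard Borel space `Y`. -/
theorem exists_measure_sequence {Y : Type*} [MetricSpace Y] [SecondCountableTopology Y]
    [MeasurableSpace Y] [BorelSpace Y] [StandardBorelSpace Y] {e : Y → X} (he : Isometry e)
    (hr : MeasurableSet[borel X] (Set.range e)) (μ : ℕ → RadonProb X)
    (hμ : ∀ n, (μ n).toMeasure (Set.range e)ᶜ = 0) (σ : ℕ → RadonProb (X × X))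
    (hσ : ∀ n, σ n ∈ couplings (μ n) (μ (n + 1))) :
    ∃ P : Measure (ℕ → Y), IsProbabilityMeasure P ∧
      (∀ n A, MeasurableSet[borel X] A → P {ω | e (ω n) ∈ A} = (μ n).toMeasure A) ∧
      ∀ n, ∫⁻ ω, edist (ω n) (ω (n + 1)) ∂P =
        (σ n).lint fun p => ENNReal.ofReal (dist p.1 p.2) := by
  have hee : IsEmbedding (Prod.map e e) := he.isEmbedding.prodMap he.isEmbedding
  have hrr : MeasurableSet[borel (X × X)] (Set.range (Prod.map e e)) := by
    rw [Set.range_prodMap, Set.prod_eq]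
    exact @MeasurableSet.inter _ (borel _) _ _ (borel_preimage continuous_fst hr)
      (borel_preimage continuous_snd hr)
  have hrc : MeasurableSet[borel X] (Set.range e)ᶜ := @MeasurableSet.compl _ _ (borel X) hr
  have hnull : ∀ n, (σ n).toMeasure (Set.range (Prod.map e e))ᶜ = 0 := by
    intro n
    rw [Set.range_prodMap, Set.compl_prod_eq_union]
    refine measure_union_null ?_ ?_
    · rw [(hσ n _ hrc).1, hμ n]
    · rw [(hσ n _ hrc).2, hμ (n + 1)]
  choose ρ hρ hρA hρl using fun n => exists_measure_of_isEmbedding (σ n) hee hrr (hnull n)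
  have hfst : ∀ n A, MeasurableSet[borel X] A → (ρ n).fst (e ⁻¹' A) = (μ n).toMeasure A := by
    intro n A hA
    have hpre : MeasurableSet (e ⁻¹' A) := measurableSet_preimage he.continuous hA
    rw [← (hσ n A hA).1, Set.prod_univ, ← hρA n _ (borel_preimage continuous_fst hA),
      Measure.fst_apply hpre]
    rfl
  have hsnd : ∀ n A, MeasurableSet[borel X] A →
      (ρ n).snd (e ⁻¹' A) = (μ (n + 1)).toMeasure A := by
    intro n A hA
    have hpre : MeasurableSet (e ⁻¹' A) := measurableSet_preimage he.continuous hA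
    rw [← (hσ n A hA).2, Set.univ_prod, ← hρA n _ (borel_preimage continuous_snd hA),
      Measure.snd_apply hpre]
    rfl
  have hchain : ∀ n, (ρ n).snd = (ρ (n + 1)).fst := by
    intro n
    ext A hA
    let _ : MeasurableSpace X := borel X
    have _ : BorelSpace X := ⟨rfl⟩
    have hA' : MeasurableSet (e '' A) :=
      (he.isEmbedding.measurableEmbedding hr).measurableSet_image.2 hA
    rw [← Set.preimage_image_eq A he.injective, hsnd n _ hA', hfst (n + 1) _ hA']
  have hne : Nonempty Y := by
    by_contra hempty
    rw [not_nonempty_iff] at hempty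
    have h0 : ρ 0 Set.univ = 0 := by
      rw [Set.univ_eq_empty_iff.2 inferInstance, measure_empty]
    simp at h0
  obtain ⟨P, hP, hPσ⟩ := Measure.exists_map_eval_succ_eq ρ hchain
  refine ⟨P, hP, fun n A hA => ?_, fun n => ?_⟩
  · have hpre : MeasurableSet (e ⁻¹' A) := measurableSet_preimage he.continuous hA
    rw [← hfst n A hA, ← hPσ n, Measure.fst_apply hpre,
      Measure.map_apply (by fun_prop) (measurable_fst hpre)]
    rfl
  · rw [← hρl n _ continuous_ofReal_dist, ← hPσ n, lintegral_map (by
      simp only [Prod.map_fst, Prod.map_snd, ← edist_dist, he.edist_eq]; fun_prop) (by fun_prop)]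
    simp only [Prod.map_fst, Prod.map_snd, ← edist_dist, he.edist_eq]

/-! ### The triangle inequality -/

theorem diagonal_mem_couplings (μ : RadonProb X) :
    μ.map (fun x => (x, x)) (continuous_id.prodMk continuous_id) ∈ couplings μ μ := by
  have h := map_prodMk_mem_couplings μ (continuous_id (X := X)) continuous_id
  rwa [map_id] at h

theorem wasserstein_triangle (μ ν τ : RadonProb X) :
    wasserstein μ τ ≤ wasserstein μ ν + wasserstein ν τ := by
  have key : ∀ σ ∈ couplings μ ν, ∀ σ' ∈ couplings ν τ, wasserstein μ τ ≤
      (σ.lint fun p => ENNReal.ofReal (dist p.1 p.2)) +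
        σ'.lint fun p => ENNReal.ofReal (dist p.1 p.2) := by
    intro σ hσ σ' hσ'
    -- The two couplings are continued by diagonal couplings to an infinite chain `μ, ν, τ, τ, …`.
    let m : ℕ → RadonProb X := fun n => n.casesOn μ fun n => n.casesOn ν fun _ => τ
    let s : ℕ → RadonProb (X × X) := fun n => n.casesOn σ fun n => n.casesOn σ' fun _ =>
      τ.map (fun x => (x, x)) (continuous_id.prodMk continuous_id)
    have hs : ∀ n, s n ∈ couplings (m n) (m (n + 1)) := by
      rintro (_ | _ | n)
      exacts [hσ, hσ', diagonal_mem_couplings τ]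
    choose S hS hS0 using fun n => exists_isSigmaCompact (m n)
    let Y : Set X := ⋃ n, S n
    have hY : IsSigmaCompact Y := isSigmaCompact_iUnion S hS
    have : SigmaCompactSpace Y := isSigmaCompact_iff_sigmaCompactSpace.1 hY
    have : SecondCountableTopology Y := hY.isSeparable.secondCountableTopology
    let _ : MeasurableSpace Y := borel Y
    have _ : BorelSpace Y := ⟨rfl⟩
    have : StandardBorelSpace Y := .of_sigmaCompactSpace
    have hr : MeasurableSet[borel X] (Set.range ((↑) : Y → X)) := by
      rw [Subtype.range_coe]
      let _ : MeasurableSpace X := borel X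
      have _ : BorelSpace X := ⟨rfl⟩
      exact hY.measurableSet
    obtain ⟨P, hP, hPm, hPs⟩ := exists_measure_sequence (isometry_subtype_coe (s := Y)) hr m
      (fun n => by
        rw [Subtype.range_coe]
        exact measure_mono_null (Set.compl_subset_compl.2 (Set.subset_iUnion S n)) (hS0 n)) s hs
    calc wasserstein μ τ
        ≤ ∫⁻ ω, edist (ω 0) (ω 2) ∂P :=
          wasserstein_le_lintegral_edist P (fun ρ _ => inferInstance) isometry_subtype_coe
            (by fun_prop) (by fun_prop) (hPm 0) (hPm 2)
      _ ≤ ∫⁻ ω, edist (ω 0) (ω 1) + edist (ω 1) (ω 2) ∂P :=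
          lintegral_mono fun ω => edist_triangle _ _ _
      _ = _ := by
          rw [lintegral_add_left (by fun_prop)]
          exact congrArg₂ (· + ·) (hPs 0) (hPs 1)
  rw [wasserstein.eq_def μ ν, wasserstein.eq_def ν τ]
  simp_rw [ENNReal.iInf_add, ENNReal.add_iInf]
  exact le_iInf₂ fun σ hσ => le_iInf₂ fun σ' hσ' => key σ hσ σ' hσ'

/-! ### Limits of fast Cauchy sequences -/

/-- In a complete space, a sequence with summable consecutive Wasserstein distances has a limit,
namely the law of the almost sure limit of the glued random sequence. -/
theorem exists_wasserstein_le_tsum [CompleteSpace X] (μ : ℕ → RadonProb X) (ε : ℕ → ℝ≥0∞)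
    (hε : ∑' n, ε n ≠ ∞) (h : ∀ n, wasserstein (μ n) (μ (n + 1)) < ε n) :
    ∃ ν : RadonProb X, ∀ n, wasserstein (μ n) ν ≤ ∑' k, ε (n + k) := by
  have hσ : ∀ n, ∃ σ ∈ couplings (μ n) (μ (n + 1)),
      (σ.lint fun p => ENNReal.ofReal (dist p.1 p.2)) < ε n := by
    intro n
    simpa only [wasserstein, iInf_lt_iff, exists_prop] using h n
  choose σ hσ hσε using hσ
  choose S hS hS0 using fun n => exists_isSigmaCompact (μ n)
  let Y : Set X := closure (⋃ n, S n)
  have hSY : ∀ n, S n ⊆ Y := fun n => (Set.subset_iUnion S n).trans subset_closure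
  have : CompleteSpace Y := isClosed_closure.completeSpace_coe
  have : SecondCountableTopology Y :=
    (isSigmaCompact_iUnion S hS).isSeparable.closure.secondCountableTopology
  let _ : MeasurableSpace Y := borel Y
  have _ : BorelSpace Y := ⟨rfl⟩
  have hr : MeasurableSet[borel X] (Set.range ((↑) : Y → X)) := by
    rw [Subtype.range_coe]
    let _ : MeasurableSpace X := borel X
    have _ : BorelSpace X := ⟨rfl⟩
    exact isClosed_closure.measurableSet
  obtain ⟨P, hP, hPm, hPs⟩ := exists_measure_sequence (isometry_subtype_coe (s := Y)) hr μ
    (fun n => by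
      rw [Subtype.range_coe]
      exact measure_mono_null (Set.compl_subset_compl.2 (hSY n)) (hS0 n)) σ hσ
  have hsum : ∫⁻ ω, ∑' n, edist (ω n) (ω (n + 1)) ∂P ≠ ∞ := by
    rw [lintegral_tsum fun n => by fun_prop]
    refine ne_top_of_le_ne_top hε (ENNReal.tsum_le_tsum fun n => ?_)
    rw [hPs n]
    exact (hσε n).le
  have hae : ∀ᵐ ω ∂P, ∑' n, edist (ω n) (ω (n + 1)) < ∞ :=
    ae_lt_top (Measurable.tsum fun n => by fun_prop) hsum
  obtain ⟨L, hL, hlim⟩ := measurable_limit_of_tendsto_metrizable_ae (μ := P) (L := atTop)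
    (f := fun n (ω : ℕ → Y) => ω n) (fun n => (measurable_pi_apply n).aemeasurable) (by
      filter_upwards [hae] with ω hω
      exact cauchySeq_tendsto_of_complete
        (cauchySeq_of_edist_le_of_tsum_ne_top _ (fun n => le_rfl) hω.ne))
  have : IsProbabilityMeasure (P.map L) := Measure.isProbabilityMeasure_map hL.aemeasurable
  refine ⟨ofMap (P.map L) ((↑) : Y → X) continuous_subtype_val, fun n => ?_⟩
  calc _ ≤ ∫⁻ ω, edist (ω n) (L ω) ∂P :=
        wasserstein_le_lintegral_edist P (fun ρ _ => inferInstance) isometry_subtype_coe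
          (by fun_prop) hL (hPm n) fun A hA => by
            rw [ofMap_apply _ _ hA]
            exact (Measure.map_apply hL (borel_preimage continuous_subtype_val hA)).symm
    _ ≤ ∫⁻ ω, ∑' k, edist (ω (n + k)) (ω (n + k + 1)) ∂P := by
        refine lintegral_mono_ae ?_
        filter_upwards [hlim] with ω hω
        exact edist_le_tsum_of_edist_le_of_tendsto _ (fun n => le_rfl) hω n
    _ = ∑' k, ∫⁻ ω, edist (ω (n + k)) (ω (n + k + 1)) ∂P := lintegral_tsum fun k => by fun_prop
    _ ≤ ∑' k, ε (n + k) := ENNReal.tsum_le_tsum fun k => by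
        rw [hPs (n + k)]
        exact (hσε _).le

/-! ### The metric space of measures with finite first moment -/

theorem wasserstein_lt_top {μ ν : RadonProb X} (hμ : μ ∈ RadonProbOne X)
    (hν : ν ∈ RadonProbOne X) : wasserstein μ ν < ∞ := by
  obtain ⟨x, hx⟩ := hμ
  obtain ⟨y, hy⟩ := hν
  have hδ : ∀ (τ : RadonProb X) (z : X), wasserstein τ
      (τ.map (fun _ => z) continuous_const) ≤ τ.lint fun w => ENNReal.ofReal (dist w z) := by
    intro τ z
    simpa only [map_id, id] using wasserstein_map_le τ continuous_id (continuous_const (y := z))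
  have hxy : wasserstein (μ.map (fun _ => x) continuous_const)
      (μ.map (fun _ => y) continuous_const) ≤ ENNReal.ofReal (dist x y) :=
    (wasserstein_map_le μ continuous_const continuous_const).trans_eq (lint_const _ _)
  -- The path from `μ` to `ν` goes through the Dirac measures at `x` and `y`.
  have h1 := wasserstein_triangle μ (μ.map (fun _ => x) continuous_const) ν
  have h2 := wasserstein_triangle (μ.map (fun _ => x) continuous_const)
    (μ.map (fun _ => y) continuous_const) ν
  have h3 := hδ ν y
  rw [← map_const μ ν, wasserstein_comm] at h3
  calc wasserstein μ ν
      ≤ _ := h1.trans (add_le_add (hδ μ x) (h2.trans (add_le_add hxy h3)))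
    _ < ∞ := ENNReal.add_lt_top.2 ⟨hx, ENNReal.add_lt_top.2 ⟨ENNReal.ofReal_lt_top, hy⟩⟩

theorem mem_radonProbOne_of_wasserstein_lt_top {μ ν : RadonProb X} (hμ : μ ∈ RadonProbOne X)
    (h : wasserstein μ ν < ∞) : ν ∈ RadonProbOne X := by
  obtain ⟨x, hx⟩ := hμ
  exact ⟨x, (lint_dist_le_add_wasserstein μ ν x).trans_lt (ENNReal.add_lt_top.2 ⟨hx, h⟩)⟩

/-- The Wasserstein metric on the Radon probability measures with finite first moment. -/
noncomputable abbrev metricSpaceRadonProbOne : MetricSpace (RadonProbOne X) where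
  dist μ ν := (wasserstein (μ : RadonProb X) ν).toReal
  dist_self μ := by simp [wasserstein_self]
  dist_comm μ ν := by rw [wasserstein_comm]
  dist_triangle μ ν τ := by
    rw [← ENNReal.toReal_add (wasserstein_lt_top μ.2 ν.2).ne (wasserstein_lt_top ν.2 τ.2).ne]
    exact ENNReal.toReal_mono (ENNReal.add_lt_top.2
      ⟨wasserstein_lt_top μ.2 ν.2, wasserstein_lt_top ν.2 τ.2⟩).ne (wasserstein_triangle _ _ _)
  eq_of_dist_eq_zero {μ ν} h := Subtype.ext <| eq_of_wasserstein_eq_zero <|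
    ((ENNReal.toReal_eq_zero_iff _).1 h).resolve_right (wasserstein_lt_top μ.2 ν.2).ne

theorem completeSpace_radonProbOne [CompleteSpace X] :
    @CompleteSpace (RadonProbOne X) metricSpaceRadonProbOne.toUniformSpace := by
  let _ : MetricSpace (RadonProbOne X) := metricSpaceRadonProbOne
  refine Metric.complete_of_convergent_controlled_sequences (fun n => (1 / 2 : ℝ) ^ n)
    (fun n => by positivity) fun u hu => ?_
  have hsum : Summable fun n : ℕ => (1 / 2 : ℝ) ^ n := summable_geometric_two
  obtain ⟨ν, hν⟩ := exists_wasserstein_le_tsum (fun n => (u n : RadonProb X))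
    (fun n => ENNReal.ofReal ((1 / 2 : ℝ) ^ n)) hsum.tsum_ofReal_ne_top fun n =>
      (ENNReal.lt_ofReal_iff_toReal_lt (wasserstein_lt_top (u n).2 (u (n + 1)).2).ne).2
        (hu n n (n + 1) le_rfl n.le_succ)
  have htail : Tendsto (fun n => ∑' k, ENNReal.ofReal ((1 / 2 : ℝ) ^ (n + k))) atTop (𝓝 0) := by
    simpa only [add_comm] using
      ENNReal.tendsto_sum_nat_add (fun n => ENNReal.ofReal ((1 / 2 : ℝ) ^ n))
        hsum.tsum_ofReal_ne_top
  have hν0 : wasserstein (u 0 : RadonProb X) ν < ∞ := by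
    refine (hν 0).trans_lt ?_
    simpa only [zero_add] using hsum.tsum_ofReal_lt_top
  refine ⟨⟨ν, mem_radonProbOne_of_wasserstein_lt_top (u 0).2 hν0⟩, ?_⟩
  rw [tendsto_iff_dist_tendsto_zero]
  exact (ENNReal.tendsto_toReal ENNReal.zero_ne_top).comp
    (tendsto_of_tendsto_of_tendsto_of_le_of_le tendsto_const_nhds htail (fun _ => zero_le) hν)

end RadonProb

theorem theorem1 {X : Type*} [MetricSpace X] :
    ∃ _ : MetricSpace (RadonProbOne X),
      (∀ μ ν : RadonProbOne X,
        ENNReal.ofReal (dist μ ν) = RadonProb.wasserstein (μ : RadonProb X) (ν : RadonProb X)) ∧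
      (CompleteSpace X → CompleteSpace (RadonProbOne X)) :=
  ⟨RadonProb.metricSpaceRadonProbOne,
    fun μ ν => ENNReal.ofReal_toReal (RadonProb.wasserstein_lt_top μ.2 ν.2).ne,
    fun _ => RadonProb.completeSpace_radonProbOne⟩
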